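/- Let $\mathbb{F}_q$ be a finite field of characteristic $2$, let $k\ge 3$, $n=2k$, and let $E$ be one of the elliptic curves * (second type) $y^2+y=f(x)$ with $f\in\mathbb{F}_q[x]$, $\deg f=3$; * (third type) $y^2+y=x+\frac{1}{ax+b}$ with $a,b\in\mathbb{F}_q$, $a\neq 0$. Put $h(x)=1$ for the second type and $h(x)=ax+b$ for the third type. Let $T\subseteq\mathbb{F}_q$ be a set of $x$-coordinates of affine $\mathbb{F}_q$-rational points of $E$ (for the third type, points satisfy $a\alpha+b\ne0$), and let $P_i=(\alpha_i,\beta_i)$, $1\le i\le n$, be all the affine rational points of $E$ with $\alpha_i\in T$, listed without repetition (so $\#T=k$). Put $t=\prod_{\alpha\in T}(x-\alpha)$ and $\gamma_i=\mathrm{res}_{P_i}(dx/t)$. Let $\eta\in\mathbb{F}_q^*$ and $\mathbf v\in(\mathbb{F}_q^*)^n$. Let $\ell=\frac{k-3}{2}$ if $k$ is odd, $\ell=\frac k2$ if $k$ is even, and let $S_\ell$ be the set of all functions $$\sum_{i=0}^{(k-1)/2}a_ix^i+\sum_{j=0}^{(k-3)/2}b_jx^jh(x)y+b_\ell\,\eta\,x^{(k+1)/2}\quad(k\text{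 odd}),$$ $$\sum_{i=0}^{k/2}a_ix^i+\sum_{j=0}^{(k-4)/2}b_jx^jh(x)y+a_\ell\,\eta\,x^{(k-2)/2}h(x)y\quad(k\text{ even}),$$ with $a_i,b_j\in\mathbb{F}_q$. Let $\mathcal C=\{(v_1f(P_1),\dots,v_nf(P_n)) : f\in S_\ell\}$ be the twisted generalized elliptic curve code (TGECC), and call $\mathcal C$ self-dual if it equals its dual for the standard bilinear form $\sum_i c_iw_i$ on $\mathbb{F}_q^n$. 1. Second type. If $k$ is odd, $\mathcal C$ is self-dual if and only if $\sum_{i=1}^n\gamma_i\alpha_i^{k+1}=0$ and there is $\lambda\in\mathbb{F}_q^*$ with $v_i^2=\lambda\gamma_i$ for all $i$. If $k$ is even, $\mathcal C$ is self-dual if and only if $\sum_{i=1}^n\gamma_i\alpha_i^{k-2}\beta_i^2=0$ and there is $\mu\in\mathbb{F}_q^*$ with $v_i^2=\mu\gamma_i$ for all $i$. 2. Third type. If $k$ is odd, $\mathcal C$ is self-dual if and only if $\sum_{i=1}^n\frac{\gamma_i}{a\alpha_i+b}\alpha_i^{k+1}=0$ and there is $\lambda\in\mathbb{F}_q^*$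 with $v_i^2=\frac{\lambda\gamma_i}{a\alpha_i+b}$ for all $i$. If $k$ is even, $\mathcal C$ is self-dual if and only if $\sum_{i=1}^n\gamma_i(a\alpha_i+b)\alpha_i^{k-2}\beta_i=0$ and there is $\mu\in\mathbb{F}_q^*$ with $v_i^2=\frac{\mu\gamma_i}{a\alpha_i+b}$ for all $i$. -/

import Mathlib

open Polynomial
open scoped Polynomial.Bivariate

namespace TwistedEllipticCode

/-- The two Artin-Schreier models `y² + y = r(x)` of an elliptic function field over a field of
characteristic two: the second type `y² + y = f(x)`, and the third type
`y² + y = x + 1 / (a x + b)`. -/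
inductive Model (K : Type*) [Field K] where
  | second (f : K[X]) : Model K
  | third (a b : K) : Model K

variable {K : Type*} [Field K]

namespace Model

/-- The condition on the coefficients in each type: `deg f = 3`, respectively `a ≠ 0`. -/
def IsElliptic : Model K → Prop
  | second f => f.natDegree = 3
  | third a _ => a ≠ 0

/-- The affine rational points `(α, β)`. In the third type the point over the zero of `a x + b`,
at which `y` has a pole, is not among them. -/
def OnCurve : Model K → K × K → Prop
  | second f, P => P.2 ^ 2 + P.2 = f.eval P.1
  | third a b, P => a * P.1 + b ≠ 0 ∧ P.2 ^ 2 + P.2 = P.1 + 1 / (a * P.1 + b)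

/-- The factor `h(x)` such that `x ^ i` and `x ^ j * h(x) * y` form a basis of the functions whose
only pole is at infinity: `1` for the second type, `a x + b` for the third. -/
noncomputable def factor : Model K → K[X]
  | second _ => 1
  | third a b => C a * X + C b

/-- The expansion of the right hand side `r(x)` of the equation in powers of `x - α`. -/
noncomputable def rhsSeries : Model K → K → PowerSeries K
  | second f, α => aeval (PowerSeries.X + PowerSeries.C α) f
  | third a b, α => (PowerSeries.X + PowerSeries.C α) +
      (PowerSeries.C a * (PowerSeries.X + PowerSeries.C α) + PowerSeries.C b)⁻¹

end Model

/-- The coefficients of the power series `Y` with constant term `β` and `Y² + Y = g`, in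
characteristic two. -/
noncomputable def artinSchreierCoeff (g : PowerSeries K) (β : K) : ℕ → K
  | 0 => β
  | n + 1 => PowerSeries.coeff (n + 1) g -
      if Even (n + 1) then artinSchreierCoeff g β ((n + 1) / 2) ^ 2 else 0
decreasing_by omega

/-- The power series `Y` with constant term `β` and `Y² + Y = g`, in characteristic two. -/
noncomputable def artinSchreierSeries (g : PowerSeries K) (β : K) : PowerSeries K :=
  PowerSeries.mk (artinSchreierCoeff g β)

theorem constantCoeff_artinSchreierSeries (g : PowerSeries K) (β : K) :
    PowerSeries.constantCoeff (artinSchreierSeries g β) = β := by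
  simp [artinSchreierSeries, ← PowerSeries.coeff_zero_eq_constantCoeff_apply, artinSchreierCoeff]

theorem artinSchreierSeries_spec [CharP K 2] (g : PowerSeries K) (β : K)
    (h : β ^ 2 + β = PowerSeries.constantCoeff g) :
    artinSchreierSeries g β ^ 2 + artinSchreierSeries g β = g := by
  set A := artinSchreierSeries g β with hA
  have hsq : A ^ 2 = PowerSeries.map (frobenius K 2) (PowerSeries.expand 2 two_ne_zero A) :=
    (MvPowerSeries.map_frobenius_expand (p := 2) two_ne_zero (f := A)).symm
  ext n
  rw [map_add, hsq, PowerSeries.coeff_map, PowerSeries.coeff_expand, frobenius_def]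
  have hc : ∀ m, PowerSeries.coeff m A = artinSchreierCoeff g β m := fun m => by
    simp [hA, artinSchreierSeries]
  cases n with
  | zero => simpa [hc, artinSchreierCoeff] using h
  | succ n =>
    rw [hc, hc, artinSchreierCoeff]
    by_cases he : 2 ∣ n + 1
    · rw [if_pos he, if_pos (even_iff_two_dvd.mpr he)]
      ring
    · rw [if_neg he, if_neg (fun h' => he (even_iff_two_dvd.mp h'))]
      simp

/-- Scalar multiplication on bivariate polynomials. -/
theorem smul_eq_CC_mul (c : K) (g : K[X][Y]) : c • g = C (C c) * g := by
  rw [Algebra.smul_def]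
  rfl

namespace Model

/-- The expansion of the function `y` at the affine point `P = (α, β)` in powers of the local
uniformizer `x - α`. -/
noncomputable def ySeries (E : Model K) (P : K × K) : PowerSeries K :=
  artinSchreierSeries (E.rhsSeries P.1) P.2

theorem constantCoeff_rhsSeries (E : Model K) (P : K × K) (hP : E.OnCurve P) :
    P.2 ^ 2 + P.2 = PowerSeries.constantCoeff (E.rhsSeries P.1) := by
  cases E with
  | second f =>
    have h0 : PowerSeries.constantCoeff (PowerSeries.X + PowerSeries.C P.1) = P.1 := by simp
    have h1 := Polynomial.hom_eval₂ f (algebraMap K (PowerSeries K)) PowerSeries.constantCoeff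
      (PowerSeries.X + PowerSeries.C P.1)
    have h2 : (PowerSeries.constantCoeff (R := K)).comp (algebraMap K (PowerSeries K)) =
        RingHom.id K := by ext; simp
    rw [h0, h2] at h1
    change _ = PowerSeries.constantCoeff (eval₂ (algebraMap K (PowerSeries K)) _ f)
    rw [h1]
    exact hP
  | third a b => simpa [rhsSeries] using hP.2

/-- At an affine point, `ySeries` solves the equation of the curve. -/
theorem ySeries_spec [CharP K 2] (E : Model K) (P : K × K) (hP : E.OnCurve P) :
    E.ySeries P ^ 2 + E.ySeries P = E.rhsSeries P.1 :=
  artinSchreierSeries_spec _ _ (E.constantCoeff_rhsSeries P hP)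

/-- The expansion of a polynomial function `g(x, y)` at the affine point `P = (α, β)` in powers of
the local uniformizer `x - α`. -/
noncomputable def expansion (E : Model K) (P : K × K) (g : K[X][Y]) : PowerSeries K :=
  g.eval₂ (aeval (PowerSeries.X + PowerSeries.C P.1) : K[X] →ₐ[K] PowerSeries K).toRingHom
    (E.ySeries P)

/-- The residue at the affine point `P = (α, β)` of the differential `(N / M) dx`, where `N / M` is a
rational function on the curve: as `dx = d(x - α)` and `x - α` is a local uniformizer at `P`, it is
the coefficient of `(x - α) ^ (-1)` in the expansion of `N / M`. -/
noncomputable def residue (E : Model K) (P : K × K) (N M : K[X][Y]) : K :=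
  ((E.expansion P N : LaurentSeries K) / (E.expansion P M : LaurentSeries K)).coeff (-1)

/-- The defining set with one twist for odd `k`: all functions
`∑_{i ≤ (k-1)/2} a_i x^i + ∑_{j ≤ (k-3)/2} b_j x^j h y + b_ℓ η x^((k+1)/2)`. -/
noncomputable def definingSetOdd (E : Model K) (k l : ℕ) (η : K) : Submodule K K[X][Y] where
  carrier := {g | ∃ a b : ℕ → K, g =
    C (∑ i ∈ Finset.range ((k - 1) / 2 + 1), C (a i) * X ^ i) +
    C (∑ j ∈ Finset.range ((k - 3) / 2 + 1), C (b j) * X ^ j * E.factor) * Y +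
    C (C (b l * η) * X ^ ((k + 1) / 2))}
  zero_mem' := ⟨0, 0, by simp⟩
  add_mem' := by
    rintro _ _ ⟨a, b, rfl⟩ ⟨a', b', rfl⟩
    refine ⟨a + a', b + b', ?_⟩
    simp only [Pi.add_apply, C_add, add_mul, Finset.sum_add_distrib]
    ring
  smul_mem' := by
    rintro c _ ⟨a, b, rfl⟩
    refine ⟨c • a, c • b, ?_⟩
    rw [smul_eq_CC_mul]
    simp only [ Pi.smul_apply, smul_eq_mul, C_mul, mul_assoc, ← Finset.mul_sum]
    ring

/-- The defining set with one twist for even `k`: all functions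
`∑_{i ≤ k/2} a_i x^i + ∑_{j ≤ (k-4)/2} b_j x^j h y + a_ℓ η x^((k-2)/2) h y`. -/
noncomputable def definingSetEven (E : Model K) (k l : ℕ) (η : K) : Submodule K K[X][Y] where
  carrier := {g | ∃ a b : ℕ → K, g =
    C (∑ i ∈ Finset.range (k / 2 + 1), C (a i) * X ^ i) +
    C (∑ j ∈ Finset.range ((k - 4) / 2 + 1), C (b j) * X ^ j * E.factor) * Y +
    C (C (a l * η) * X ^ ((k - 2) / 2) * E.factor) * Y}
  zero_mem' := ⟨0, 0, by simp⟩
  add_mem' := by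
    rintro _ _ ⟨a, b, rfl⟩ ⟨a', b', rfl⟩
    refine ⟨a + a', b + b', ?_⟩
    simp only [Pi.add_apply, C_add, add_mul, Finset.sum_add_distrib]
    ring
  smul_mem' := by
    rintro c _ ⟨a, b, rfl⟩
    refine ⟨c • a, c • b, ?_⟩
    rw [smul_eq_CC_mul]
    simp only [ Pi.smul_apply, smul_eq_mul, C_mul, mul_assoc, ← Finset.mul_sum]
    ring

end Model

/-- The linear map `f ↦ (v_1 f(P_1), …, v_n f(P_n))`. -/
noncomputable def evalMap {n : ℕ} (P : Fin n → K × K) (v : Fin n → K) :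
    K[X][Y] →ₗ[K] (Fin n → K) where
  toFun g i := v i * g.evalEval (P i).1 (P i).2
  map_add' g g' := by
    funext i
    simp [mul_add]
  map_smul' c g := by
    funext i
    simp only [smul_eq_CC_mul, evalEval_mul, evalEval_C, eval_C, Pi.smul_apply, smul_eq_mul,
      RingHom.id_apply]
    ring

/-- The code of all words `(v_1 f(P_1), …, v_n f(P_n))` with `f` in the space `S`. -/
noncomputable def evalCode {n : ℕ} (S : Submodule K K[X][Y]) (P : Fin n → K × K) (v : Fin n → K) :
    Submodule K (Fin n → K) :=
  S.map (evalMap P v)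

/-- The dual of a linear code for the standard bilinear form on `K ^ n`. -/
def dualCode {n : ℕ} (D : Submodule K (Fin n → K)) : Submodule K (Fin n → K) where
  carrier := {w | ∀ c ∈ D, c ⬝ᵥ w = 0}
  zero_mem' := by simp
  add_mem' := by
    intro w w' hw hw' c hc
    rw [dotProduct_add, hw c hc, hw' c hc, add_zero]
  smul_mem' := by
    intro r w hw c hc
    rw [dotProduct_smul, hw c hc, smul_zero]

/-- A linear code is self-dual if it equals its dual code. -/
def IsSelfDual {n : ℕ} (D : Submodule K (Fin n → K)) : Prop :=
  dualCode D = D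

namespace Model

/-- `P_1, …, P_n` are, without repetition, all the affine rational points over the elements of `T`,
and every element of `T` is the `x`-coordinate of such a point: `P_1 + ⋯ + P_n` is the conorm of
the divisor of `T` on the line. -/
structure IsConorm (E : Model K) (T : Finset K) {n : ℕ} (P : Fin n → K × K) : Prop where
  injective : Function.Injective P
  range_eq : Set.range P = {Q | E.OnCurve Q ∧ Q.1 ∈ T}
  exists_point : ∀ α ∈ T, ∃ β, E.OnCurve (α, β)

/-- The residue at the affine point `Q` of the differential `dx / t`, `t = ∏_{α ∈ T} (x - α)`. -/
noncomputable def gamma (E : Model K) (T : Finset K) (Q : K × K) : K :=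
  E.residue Q 1 (C (∏ α ∈ T, (X - C α)))

/-- The twisted generalized elliptic curve code of dimension parameter `k`, twist position
`l`, twist coefficient `η` and scaling vector `v`. -/
noncomputable def tgecc (E : Model K) {n : ℕ} (P : Fin n → K × K) (k l : ℕ) (η : K)
    (v : Fin n → K) : Submodule K (Fin n → K) :=
  evalCode (if Odd k then E.definingSetOdd k l η else E.definingSetEven k l η) P v

end Model

end TwistedEllipticCode

open TwistedEllipticCode

/-! The fibre of the curve over `α ∈ T` is `{(α, β), (α, β + 1)}`, and `γ` is the Lagrange nodal
weight `1 / t'(α)` at both points (`gamma_eq_nodalWeight`). The code is the image of the pairs `(A,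
B)`, read as `A + B h y`, whose top coefficients satisfy one linear relation. Evaluation is
injective on them, so the code has dimension at least `k = n / 2`, and self-duality reduces to
self-orthogonality.

Summing over fibres and eliminating `y²` turns the inner product into `fibreForm`, which sees the
weights `v_i²` only through their fibre sums `p` and the fibre sums `q` of weight times `y`.
Orthogonality says that many power moments of `p` and `q h` on `T` vanish; this forces `p = 0`
(`eq_zero_of_fibreForm`) and `q h = c * nodalWeight` (`exists_eq_mul_nodalWeight_of_fibreForm`),
that is, `v_i² h(α_i) = c γ_i`. Conversely, with such weights the form is `c` times one coefficient
of a polynomial (`fibreForm_eq`): the twist terms cancel in characteristic two, and what remains is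
zero for odd `k` and involves the linear coefficient of `h` for even `k`.

The sums in the theorem measure exactly this remainder: they vanish, except for the third type with
even `k`, where the sum is `a ≠ 0` and no code is self-dual. -/

namespace TwistedEllipticCode

/-! ### Power moments on a finite set and nodal weights. -/

section Lagrange

variable {K : Type*} [Field K] [DecidableEq K]

open Lagrange

/-- A sum of the values of a polynomial of degree less than `#T`, weighted by the nodal weights of
`T`, is its coefficient at `#T - 1`. -/
theorem sum_nodalWeight_mul_eval (T : Finset K) {B : K[X]} (hB : B.degree < T.card) :
    ∑ α ∈ T, nodalWeight T id α * B.eval α = B.coeff (T.card - 1) := by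
  rw [coeff_eq_sum (v := id) Function.injective_id.injOn hB]
  refine Finset.sum_congr rfl fun α _ => ?_
  rw [nodalWeight, Finset.prod_inv_distrib, div_eq_inv_mul]
  rfl

/-- A function on `T` is zero if its power moments of order less than `#T` vanish. -/
theorem eq_zero_of_moments {T : Finset K} {u : K → K}
    (hu : ∀ j < T.card, ∑ α ∈ T, u α * α ^ j = 0) : ∀ α ∈ T, u α = 0 := by
  have key : ∀ B : K[X], B.degree < T.card → ∑ α ∈ T, u α * B.eval α = 0 := by
    intro B hB
    by_cases hT : T.card = 0
    · rw [Finset.card_eq_zero] at hT; simp [hT]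
    · have hB' : B.natDegree < T.card := by
        rcases eq_or_ne B 0 with rfl | h0
        · simpa [Nat.pos_iff_ne_zero] using hT
        · exact (natDegree_lt_iff_degree_lt h0).2 hB
      simp_rw [eval_eq_sum_range' hB', Finset.mul_sum]
      rw [Finset.sum_comm]
      refine Finset.sum_eq_zero fun j hj => ?_
      simp_rw [mul_left_comm _ (B.coeff j), ← Finset.mul_sum]
      rw [hu j (Finset.mem_range.1 hj), mul_zero]
  intro α hα
  -- Testing against the polynomial that interpolates the indicator of `α` isolates `u α`.
  have h := key (Lagrange.interpolate T id (Pi.single α 1))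
    (degree_interpolate_lt _ Function.injective_id.injOn)
  rw [Finset.sum_congr rfl fun x hx => by
    rw [show eval x _ = Pi.single (M := fun _ => K) α 1 x from
      eval_interpolate_at_node _ Function.injective_id.injOn hx]] at h
  simpa [Pi.single_apply, hα] using h

/-- A function on `T` whose power moments of order less than `#T - 1` vanish is a multiple of
the nodal weight. -/
theorem eq_mul_nodalWeight_of_moments {T : Finset K} {u : K → K}
    (hu : ∀ j, j + 1 < T.card → ∑ α ∈ T, u α * α ^ j = 0) :
    ∀ α ∈ T, u α = (∑ x ∈ T, u x * x ^ (T.card - 1)) * nodalWeight T id α := by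
  set c := ∑ x ∈ T, u x * x ^ (T.card - 1) with hc
  -- The nodal weight has moments `0` below order `#T - 1` and `1` at that order, so subtracting `c`
  -- times it kills every moment.
  have := eq_zero_of_moments (T := T) (u := fun α => u α - c * nodalWeight T id α) ?_
  · intro α hα; exact sub_eq_zero.1 (this α hα)
  intro j hj
  have h1 := sum_nodalWeight_mul_eval T (B := X ^ j)
    ((degree_X_pow_le j).trans_lt (by exact_mod_cast hj))
  simp only [eval_pow, eval_X, coeff_X_pow] at h1
  simp_rw [sub_mul, Finset.sum_sub_distrib, mul_assoc, ← Finset.mul_sum, h1]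
  rcases Nat.lt_or_ge (j + 1) T.card with h | h
  · rw [hu j h, if_neg (by omega)]; simp
  · obtain rfl : j = T.card - 1 := by omega
    rw [← hc]; simp

end Lagrange

/-! ### Self-duality as self-orthogonality in half the length. -/

section Dual

variable {K : Type*} [Field K]

theorem finrank_dualCode {n : ℕ} (D : Submodule K (Fin n → K)) :
    Module.finrank K (dualCode D) = n - Module.finrank K D := by
  let B : LinearMap.BilinForm K (Fin n → K) := dotProductBilin K K
  have hB : B.Nondegenerate := by
    constructor
    · intro x hx
      exact dotProduct_eq_zero _ hx
    · intro x hx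
      exact dotProduct_eq_zero _ fun w => by rw [dotProduct_comm]; exact hx w
  have h := LinearMap.BilinForm.finrank_orthogonal hB D
  rw [Module.finrank_fin_fun] at h
  exact h

/-- A code of length `2 k` and dimension at least `k` is self-dual if and only if it is
self-orthogonal. -/
theorem isSelfDual_iff_of_le_finrank {k : ℕ} {D : Submodule K (Fin (2 * k) → K)}
    (hD : k ≤ Module.finrank K D) :
    IsSelfDual D ↔ ∀ c ∈ D, ∀ w ∈ D, c ⬝ᵥ w = 0 := by
  constructor
  · intro h c hc w hw
    rw [← (show dualCode D = D from h)] at hw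
    exact hw c hc
  · intro h
    have hle : D ≤ dualCode D := fun w hw c hc => h c hc w hw
    refine (Submodule.eq_of_le_of_finrank_le hle ?_).symm
    rw [finrank_dualCode]
    omega

end Dual

/-! ### The residue of `dx / t`. -/

section Residue

variable {K : Type*} [Field K]

theorem expansion_C (E : Model K) (Q : K × K) (g : K[X]) :
    E.expansion Q (C g) = aeval (PowerSeries.X + PowerSeries.C Q.1) g := by
  simp [Model.expansion]

theorem coeff_neg_one_one_div_X_mul (u : PowerSeries K)
    (hu : PowerSeries.constantCoeff u ≠ 0) :
    ((1 : LaurentSeries K) / ((PowerSeries.X * u : PowerSeries K) : LaurentSeries K)).coeff (-1) =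
      (PowerSeries.constantCoeff u)⁻¹ := by
  have h1 : (HahnSeries.single (1 : ℤ) (1 : K)) * HahnSeries.single (-1 : ℤ) (1 : K) = 1 := by
    simp
  have h2 : ((u : PowerSeries K) : LaurentSeries K) * ((u⁻¹ : PowerSeries K) : LaurentSeries K) =
      1 := by
    rw [← PowerSeries.coe_mul, PowerSeries.mul_inv_cancel u hu, PowerSeries.coe_one]
  have h3 : (1 : LaurentSeries K) / ((PowerSeries.X * u : PowerSeries K) : LaurentSeries K) =
      HahnSeries.single (-1 : ℤ) (1 : K) * ((u⁻¹ : PowerSeries K) : LaurentSeries K) := by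
    have h4 : ((PowerSeries.X * u : PowerSeries K) : LaurentSeries K) *
        (HahnSeries.single (-1 : ℤ) (1 : K) * ((u⁻¹ : PowerSeries K) : LaurentSeries K)) = 1 := by
      rw [PowerSeries.coe_mul, PowerSeries.coe_X, mul_mul_mul_comm, h1, h2, one_mul]
    rw [div_eq_iff (left_ne_zero_of_mul_eq_one h4), mul_comm, h4]
  rw [h3]
  have h5 := HahnSeries.coeff_single_mul_add (r := (1 : K)) (a := (0 : ℤ)) (b := (-1 : ℤ))
    (x := ((u⁻¹ : PowerSeries K) : LaurentSeries K))
  rw [zero_add, one_mul] at h5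
  rw [h5]
  simp [PowerSeries.coeff_coe]

/-- Since `t` lies in `K[x]` and has a simple zero at `Q` in the uniformizer `x - α`, the residue is
`1 / t'(α)`; the expansion of `y` plays no role. -/
theorem gamma_eq_nodalWeight [DecidableEq K] (E : Model K) {T : Finset K} {Q : K × K} (hQ : Q.1 ∈ T) :
    E.gamma T Q = Lagrange.nodalWeight T id Q.1 := by
  have h1 : E.expansion Q 1 = 1 := by
    rw [← C_1, expansion_C, map_one]
  set u : PowerSeries K := ∏ α ∈ T.erase Q.1, (PowerSeries.X + PowerSeries.C (Q.1 - α)) with hu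
  have h2 : E.expansion Q (C (∏ α ∈ T, (X - C α))) = PowerSeries.X * u := by
    rw [expansion_C, map_prod, ← Finset.mul_prod_erase T _ hQ]
    congr 1
    · simp [PowerSeries.C_eq_algebraMap]
    · refine Finset.prod_congr rfl fun α _ => ?_
      simp [PowerSeries.C_eq_algebraMap, add_sub_assoc, map_sub]
  have h3 : PowerSeries.constantCoeff u = ∏ α ∈ T.erase Q.1, (Q.1 - α) := by
    rw [hu, map_prod]
    simp
  rw [Model.gamma, Model.residue, h1, h2, PowerSeries.coe_one, coeff_neg_one_one_div_X_mul, h3,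
    Lagrange.nodalWeight, Finset.prod_inv_distrib]
  · rfl
  · rw [h3]
    exact Finset.prod_ne_zero_iff.2 fun α hα =>
      sub_ne_zero.2 (Finset.ne_of_mem_erase hα).symm

end Residue

/-! ### The space of functions with tied top coefficients. -/

section TwistedPairs

variable {K : Type*} [Field K]

/-- The pairs `(A, B)` with `deg A ≤ m`, `deg B ≤ d` whose coefficients at `m` and `d` are tied by
`s * A_m = t * B_d`. -/
def twistedPairs (m d : ℕ) (s t : K) : Submodule K (K[X] × K[X]) where
  carrier := {g | g.1.natDegree ≤ m ∧ g.2.natDegree ≤ d ∧ s * g.1.coeff m = t * g.2.coeff d}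
  zero_mem' := by simp
  add_mem' := by
    rintro g g' ⟨h1, h2, h3⟩ ⟨h1', h2', h3'⟩
    refine ⟨natDegree_add_le_of_degree_le h1 h1', natDegree_add_le_of_degree_le h2 h2', ?_⟩
    simp only [Prod.fst_add, Prod.snd_add, coeff_add]
    linear_combination h3 + h3'
  smul_mem' := by
    rintro c g ⟨h1, h2, h3⟩
    refine ⟨(natDegree_smul_le _ _).trans h1, (natDegree_smul_le _ _).trans h2, ?_⟩
    simp only [Prod.smul_fst, Prod.smul_snd, coeff_smul, smul_eq_mul]
    linear_combination c * h3

/-- The word of the function `A(x) + B(x) h(x) y`, scaled by `v`. -/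
noncomputable def pairEval {n : ℕ} (h : K[X]) (P : Fin n → K × K) (v : Fin n → K) :
    K[X] × K[X] →ₗ[K] (Fin n → K) where
  toFun g i := v i * (g.1.eval (P i).1 + g.2.eval (P i).1 * h.eval (P i).1 * (P i).2)
  map_add' g g' := by
    funext i
    simp
    ring
  map_smul' c g := by
    funext i
    simp
    ring

theorem pairEval_apply {n : ℕ} (h : K[X]) (P : Fin n → K × K) (v : Fin n → K)
    (g : K[X] × K[X]) (i : Fin n) :
    pairEval h P v g i =
      v i * (g.1.eval (P i).1 + g.2.eval (P i).1 * h.eval (P i).1 * (P i).2) :=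
  rfl

theorem finrank_degreeLT (n : ℕ) : Module.finrank K (degreeLT K n) = n := by
  rw [(degreeLTEquiv K n).finrank_eq, Module.finrank_fin_fun]

/-- As `s ≠ 0`, the tie determines `A_m` from `B_d`: the `m` lower coefficients of `A` and the `d +
1` coefficients of `B` are free parameters. -/
theorem le_finrank_map_twistedPairs {n : ℕ} {m d : ℕ} {s t : K} (hs : s ≠ 0)
    {F : K[X] × K[X] →ₗ[K] (Fin n → K)}
    (hF : ∀ g : K[X] × K[X], g.1.natDegree ≤ m → g.2.natDegree ≤ d → F g = 0 → g = 0) :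
    m + d + 1 ≤ Module.finrank K ((twistedPairs m d s t).map F) := by
  let A : degreeLT K m × degreeLT K (d + 1) →ₗ[K] K[X] :=
    (degreeLT K m).subtype ∘ₗ LinearMap.fst K _ _ +
      (s⁻¹ * t) • (monomial m ∘ₗ lcoeff K d ∘ₗ (degreeLT K (d + 1)).subtype ∘ₗ
        LinearMap.snd K _ _)
  let B : degreeLT K m × degreeLT K (d + 1) →ₗ[K] K[X] :=
    (degreeLT K (d + 1)).subtype ∘ₗ LinearMap.snd K _ _
  have hA : ∀ x, A x = x.1 + (s⁻¹ * t) • monomial m ((x.2 : K[X]).coeff d) := fun _ => rfl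
  have hB : ∀ x, B x = x.2 := fun _ => rfl
  have hmem : ∀ x, (A x, B x) ∈ twistedPairs m d s t := by
    rintro ⟨⟨a, ha⟩, ⟨b, hb⟩⟩
    rw [mem_degreeLT] at ha hb
    refine ⟨?_, ?_, ?_⟩
    · rw [hA]
      refine natDegree_add_le_of_degree_le (natDegree_le_of_degree_le ha.le) ?_
      exact (natDegree_smul_le _ _).trans (natDegree_monomial_le _)
    · rw [hB]
      exact natDegree_le_iff_coeff_eq_zero.2 fun N hN =>
        coeff_eq_zero_of_degree_lt (hb.trans_le (by exact_mod_cast hN))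
    · simp only [hA, hB, coeff_add, coeff_smul, coeff_monomial, if_true, smul_eq_mul]
      rw [coeff_eq_zero_of_degree_lt ha]
      field_simp
      ring
  have hinj : Function.Injective (F ∘ₗ A.prod B) := by
    rw [← LinearMap.ker_eq_bot, LinearMap.ker_eq_bot']
    intro x hx
    have h0 := hF (A x, B x) (hmem x).1 (hmem x).2.1 hx
    rw [Prod.mk_eq_zero, hA, hB] at h0
    obtain ⟨h1, h2⟩ := h0
    rw [h2] at h1
    simp only [coeff_zero, map_zero, smul_zero, add_zero] at h1
    exact Prod.ext (Subtype.ext h1) (Subtype.ext h2)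
  have h1 := LinearMap.finrank_range_of_inj hinj
  rw [Module.finrank_prod, finrank_degreeLT, finrank_degreeLT] at h1
  rw [add_assoc, ← h1]
  apply Submodule.finrank_mono
  rintro _ ⟨x, rfl⟩
  exact ⟨_, hmem x, rfl⟩

end TwistedPairs

/-! ### Total isotropy of the twisted space. -/

section Orthogonality

variable {K : Type*} [Field K]

/-- The bilinear form on the functions `A + B h y` induced by weights on the points, where
`p` and `q` are the sums over a fibre of the weights and of the weights times `y`, and `R = h² r`
for the equation `y² + y = r` in characteristic two. -/
noncomputable def fibreForm (T : Finset K) (p q : K → K) (h R : K[X]) (g g' : K[X] × K[X]) : K :=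
  ∑ α ∈ T, (p α * (g.1 * g'.1 + g.2 * g'.2 * R).eval α +
    q α * h.eval α * (g.1 * g'.2 + g'.1 * g.2 + g.2 * g'.2 * h).eval α)

variable {T : Finset K} {p q : K → K} {h R : K[X]} {m d : ℕ} {s t : K}

theorem X_pow_zero_mem_twistedPairs {i : ℕ} (hi : i < m) :
    ((X ^ i, 0) : K[X] × K[X]) ∈ twistedPairs m d s t :=
  ⟨by simpa using hi.le, by simp, by simp [coeff_X_pow, hi.ne']⟩

theorem zero_X_pow_mem_twistedPairs {i : ℕ} (hi : i < d) :
    ((0, X ^ i) : K[X] × K[X]) ∈ twistedPairs m d s t :=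
  ⟨by simp, by simpa using hi.le, by simp [coeff_X_pow, hi.ne']⟩

theorem twist_mem_twistedPairs :
    ((C t * X ^ m, C s * X ^ d) : K[X] × K[X]) ∈ twistedPairs m d s t :=
  ⟨natDegree_C_mul_X_pow_le _ _, natDegree_C_mul_X_pow_le _ _, by
    simp only [coeff_C_mul, coeff_X_pow_self]
    ring⟩

/-- An exponent up to `2 * (m - 1)` splits into two exponents below `m`, and monomials below the
tied degree are untwisted. -/
theorem sum_mul_pow_eq_zero_of_fibreForm
    (H : ∀ g ∈ twistedPairs m d s t, ∀ g' ∈ twistedPairs m d s t, fibreForm T p q h R g g' = 0)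
    {j : ℕ} (hm : 1 ≤ m) (hj : j ≤ 2 * (m - 1)) : ∑ α ∈ T, p α * α ^ j = 0 := by
  have h1 := H _ (X_pow_zero_mem_twistedPairs (i := min j (m - 1)) (by omega))
    _ (X_pow_zero_mem_twistedPairs (i := j - min j (m - 1)) (by omega))
  have h2 : min j (m - 1) + (j - min j (m - 1)) = j := by omega
  simpa [fibreForm, ← pow_add, h2] using h1

theorem sum_mul_eval_mul_pow_eq_zero_of_fibreForm
    (H : ∀ g ∈ twistedPairs m d s t, ∀ g' ∈ twistedPairs m d s t, fibreForm T p q h R g g' = 0)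
    {j : ℕ} (hm : 1 ≤ m) (hd : 1 ≤ d) (hj : j ≤ (m - 1) + (d - 1)) :
    ∑ α ∈ T, q α * h.eval α * α ^ j = 0 := by
  have h1 := H _ (X_pow_zero_mem_twistedPairs (i := min j (m - 1)) (by omega))
    _ (zero_X_pow_mem_twistedPairs (i := j - min j (m - 1)) (by omega))
  have h2 : min j (m - 1) + (j - min j (m - 1)) = j := by omega
  simpa [fibreForm, ← pow_add, h2] using h1

open Lagrange

variable [DecidableEq K]

/-- For `m = d + 2` the available moments of `p` already reach order `#T - 1`. For `m = d + 1` they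
stop one short, leaving a multiple `c` of the nodal weight; pairing `x ^ (d - 1) h y` with itself
then gives `c` times the leading coefficient of the cubic `R`. -/
theorem eq_zero_of_fibreForm (hT : T.card = m + d + 1)
    (hmd : m = d + 2 ∨ m = d + 1 ∧ 1 ≤ d) (hh : h.natDegree ≤ 1) (hR : R.natDegree = 3)
    (H : ∀ g ∈ twistedPairs m d s t, ∀ g' ∈ twistedPairs m d s t, fibreForm T p q h R g g' = 0) :
    ∀ α ∈ T, p α = 0 := by
  rcases hmd with rfl | ⟨rfl, hd⟩
  · exact eq_zero_of_moments fun j hj =>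
      sum_mul_pow_eq_zero_of_fibreForm H (by omega) (by omega)
  · have hp := eq_mul_nodalWeight_of_moments (T := T) (u := p) fun j hj =>
      sum_mul_pow_eq_zero_of_fibreForm H (by omega) (by omega)
    set c := ∑ x ∈ T, p x * x ^ (T.card - 1)
    suffices hc : c = 0 by
      intro α hα
      rw [hp α hα, hc, zero_mul]
    obtain ⟨e, rfl⟩ : ∃ e, d = e + 1 := ⟨d - 1, by omega⟩
    have h1 := H _ (zero_X_pow_mem_twistedPairs (i := e) (by omega))
      _ (zero_X_pow_mem_twistedPairs (i := e) (by omega))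
    have hq : ∀ j ≤ 2 * e + 1, ∑ α ∈ T, q α * h.eval α * α ^ j = 0 := fun j hj =>
      sum_mul_eval_mul_pow_eq_zero_of_fibreForm H (by omega) hd (by omega)
    -- As `deg h ≤ 1`, only moments of `q h` of order at most `2 * e + 1` occur, and all of these
    -- vanish.
    have h2 : ∑ α ∈ T, q α * h.eval α * (X ^ e * X ^ e * h).eval α = 0 := by
      have h3 : ∀ α, q α * h.eval α * (X ^ e * X ^ e * h).eval α =
          h.coeff 1 * (q α * h.eval α * α ^ (2 * e + 1)) +
          h.coeff 0 * (q α * h.eval α * α ^ (2 * e)) := by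
        intro α
        have h4 : h.eval α = h.coeff 1 * α + h.coeff 0 := by
          conv_lhs => rw [eq_X_add_C_of_natDegree_le_one hh]
          simp
        have h5 : (X ^ e * X ^ e * h).eval α = α ^ e * α ^ e * (h.coeff 1 * α + h.coeff 0) := by
          rw [← h4]; simp
        rw [h5]
        ring
      simp_rw [h3, Finset.sum_add_distrib, ← Finset.mul_sum]
      rw [hq _ le_rfl, hq _ (by omega)]
      simp
    have h6 : ∑ α ∈ T, p α * (X ^ e * X ^ e * R).eval α = c * R.coeff 3 := by
      have h7 := sum_nodalWeight_mul_eval T (B := X ^ e * X ^ e * R) (by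
        rw [hT]
        refine lt_of_le_of_lt degree_le_natDegree ?_
        rw [← pow_add]
        have := natDegree_mul_le (p := (X : K[X]) ^ (e + e)) (q := R)
        rw [natDegree_X_pow] at this
        norm_cast
        omega)
      rw [hT, ← pow_add, show e + 1 + 1 + (e + 1) + 1 - 1 = 3 + (e + e) by omega,
        coeff_X_pow_mul] at h7
      rw [← h7, Finset.mul_sum]
      refine Finset.sum_congr rfl fun α hα => ?_
      rw [hp α hα, ← pow_add]
      ring
    simp only [fibreForm, zero_mul, mul_zero, zero_add, Finset.sum_add_distrib] at h1
    rw [h2, add_zero, h6] at h1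
    refine (mul_eq_zero.1 h1).resolve_right ?_
    rw [← hR]
    exact leadingCoeff_ne_zero.2 fun h0 => by simp [h0] at hR

/-- Untwisted monomials give moments up to order `m + d - 2`; the twist element supplies the
remaining order `m + d - 1`. Its `A`-part is harmless because `p = 0`. -/
theorem exists_eq_mul_nodalWeight_of_fibreForm (hT : T.card = m + d + 1) (hm : 1 ≤ m)
    (hs : s ≠ 0) (hp : ∀ α ∈ T, p α = 0)
    (H : ∀ g ∈ twistedPairs m d s t, ∀ g' ∈ twistedPairs m d s t, fibreForm T p q h R g g' = 0) :
    ∃ c, ∀ α ∈ T, q α * h.eval α = c * nodalWeight T id α := by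
  refine ⟨_, eq_mul_nodalWeight_of_moments (u := fun α => q α * h.eval α) fun j hj => ?_⟩
  have h2 : min j (m - 1) + (j - min j (m - 1)) = j := by omega
  have key : ∀ (A : K[X]) (r : K), r ≠ 0 →
      (A, C r * X ^ (j - min j (m - 1))) ∈ twistedPairs m d s t →
      ∑ α ∈ T, q α * h.eval α * α ^ j = 0 := by
    intro A r hr hA
    have h1 := H _ (X_pow_zero_mem_twistedPairs (i := min j (m - 1)) (by omega)) _ hA
    have h3 : fibreForm T p q h R (X ^ min j (m - 1), 0) (A, C r * X ^ (j - min j (m - 1))) =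
        r * ∑ α ∈ T, q α * h.eval α * α ^ j := by
      rw [fibreForm, Finset.mul_sum]
      refine Finset.sum_congr rfl fun α hα => ?_
      have h4 : α ^ j = α ^ min j (m - 1) * α ^ (j - min j (m - 1)) := by rw [← pow_add, h2]
      rw [hp α hα, h4]
      simp
      ring
    rw [h3] at h1
    exact (mul_eq_zero.1 h1).resolve_left hr
  rcases Nat.lt_or_ge (j - min j (m - 1)) d with hlt | hge
  · exact key 0 1 one_ne_zero (by simpa using zero_X_pow_mem_twistedPairs hlt)
  · have h4 : j - min j (m - 1) = d := by omega
    exact key _ s hs (by rw [h4]; exact twist_mem_twistedPairs)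

/-- Nodal weights extract the coefficient at `#T - 1 = m + d`, where only top coefficients
contribute. -/
theorem fibreForm_eq [CharP K 2] (hT : T.card = m + d + 1) (hmd : m = d + 2 ∨ m = d + 1)
    (hh : h.natDegree ≤ 1) (hs : s ≠ 0) (hp : ∀ α ∈ T, p α = 0) {c : K}
    (hq : ∀ α ∈ T, q α * h.eval α = c * nodalWeight T id α)
    {g g' : K[X] × K[X]} (hg : g ∈ twistedPairs m d s t) (hg' : g' ∈ twistedPairs m d s t) :
    fibreForm T p q h R g g' =
      if m = d + 1 then c * (g.2.coeff d * g'.2.coeff d * h.coeff 1) else 0 := by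
  obtain ⟨hA, hB, hAB⟩ := hg
  obtain ⟨hA', hB', hAB'⟩ := hg'
  have hBB : (g.2 * g'.2).natDegree ≤ d + d := natDegree_mul_le_of_le hB hB'
  have hBBh : (g.2 * g'.2 * h).natDegree ≤ d + d + 1 := natDegree_mul_le_of_le hBB hh
  have h1 : fibreForm T p q h R g g' =
      c * (g.1 * g'.2 + g'.1 * g.2 + g.2 * g'.2 * h).coeff (m + d) := by
    have h2 := sum_nodalWeight_mul_eval T (B := g.1 * g'.2 + g'.1 * g.2 + g.2 * g'.2 * h) (by
      rw [hT]
      refine lt_of_le_of_lt degree_le_natDegree ?_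
      norm_cast
      refine Nat.lt_succ_iff.2 (natDegree_add_le_of_degree_le (natDegree_add_le_of_degree_le
        (natDegree_mul_le_of_le hA hB') (natDegree_mul_le_of_le hA' hB)) ?_)
      omega)
    rw [hT, Nat.add_sub_cancel] at h2
    rw [← h2, fibreForm, Finset.mul_sum]
    refine Finset.sum_congr rfl fun α hα => ?_
    rw [hp α hα, hq α hα]
    ring
  -- Times `s`, the tie turns both terms into `t * B_d * B'_d`, so they cancel in characteristic
  -- two.
  have h3 : g.1.coeff m * g'.2.coeff d + g'.1.coeff m * g.2.coeff d = 0 := by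
    refine mul_left_cancel₀ hs ?_
    linear_combination g'.2.coeff d * hAB + g.2.coeff d * hAB' +
      t * CharTwo.add_self_eq_zero (g.2.coeff d * g'.2.coeff d)
  rw [h1, coeff_add, coeff_add, coeff_mul_add_eq_of_natDegree_le hA hB',
    coeff_mul_add_eq_of_natDegree_le hA' hB, h3, zero_add]
  rcases hmd with rfl | rfl
  · rw [if_neg (by omega), coeff_eq_zero_of_natDegree_lt (by omega), mul_zero]
  · rw [if_pos rfl, show d + 1 + d = d + d + 1 by omega,
      coeff_mul_add_eq_of_natDegree_le hBB hh, coeff_mul_add_eq_of_natDegree_le hB hB']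

/-- The twisted space is totally isotropic if and only if the weights are constant on fibres,
proportional to `1 / h` times the nodal weights, and, for even `k`, the factor `h` is constant. -/
theorem fibreForm_eq_zero_iff [CharP K 2] (hT : T.card = m + d + 1)
    (hmd : m = d + 2 ∨ m = d + 1 ∧ 1 ≤ d) (hh : h.natDegree ≤ 1) (hR : R.natDegree = 3)
    (hs : s ≠ 0) (hhT : ∀ α ∈ T, h.eval α ≠ 0) (hpq : ∀ α ∈ T, p α = 0 → q α ≠ 0) :
    (∀ g ∈ twistedPairs m d s t, ∀ g' ∈ twistedPairs m d s t, fibreForm T p q h R g g' = 0) ↔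
      (m = d + 1 → h.coeff 1 = 0) ∧ (∀ α ∈ T, p α = 0) ∧
        ∃ c, c ≠ 0 ∧ ∀ α ∈ T, q α * h.eval α = c * nodalWeight T id α := by
  have hmd' : m = d + 2 ∨ m = d + 1 := hmd.imp_right And.left
  constructor
  · intro H
    have hp := eq_zero_of_fibreForm hT hmd hh hR H
    obtain ⟨c, hc⟩ := exists_eq_mul_nodalWeight_of_fibreForm hT (by omega) hs hp H
    have hc0 : c ≠ 0 := by
      rintro rfl
      obtain ⟨α, hα⟩ : T.Nonempty := Finset.card_pos.1 (by omega)
      have := hc α hα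
      rw [zero_mul] at this
      exact mul_ne_zero (hpq α hα (hp α hα)) (hhT α hα) this
    refine ⟨fun h1 => ?_, hp, c, hc0, hc⟩
    -- The twist element paired with itself gives `c * s ^ 2 * h.coeff 1`.
    have h2 := fibreForm_eq (R := R) hT hmd' hh hs hp hc twist_mem_twistedPairs
      (twist_mem_twistedPairs (t := t))
    rw [H _ twist_mem_twistedPairs _ twist_mem_twistedPairs, if_pos h1] at h2
    simpa [hc0, hs] using h2.symm
  · rintro ⟨h1, hp, c, -, hc⟩ g hg g' hg'
    rw [fibreForm_eq hT hmd' hh hs hp hc hg hg']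
    split_ifs with h2
    · rw [h1 h2, mul_zero, mul_zero]
    · rfl

end Orthogonality

/-! ### Fibres of the curve and the codes on it. -/

section Curve

variable {K : Type*} [Field K]

namespace Model

/-- The polynomial `h² r`, where `y² + y = r(x)` is the equation and `h` is `factor`. -/
noncomputable def clearedRhs : Model K → K[X]
  | second f => f
  | third a b => (C a * X + C b) ^ 2 * X + (C a * X + C b)

theorem natDegree_clearedRhs {E : Model K} (hE : E.IsElliptic) : E.clearedRhs.natDegree = 3 := by
  cases E with
  | second f => exact hE
  | third a b =>
    have ha : a ≠ 0 := hE
    rw [clearedRhs]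
    compute_degree!

theorem natDegree_factor_le (E : Model K) : E.factor.natDegree ≤ 1 := by
  cases E with
  | second f => simp [factor]
  | third a b => exact natDegree_linear_le

theorem eval_factor_ne_zero {E : Model K} {Q : K × K} (hQ : E.OnCurve Q) :
    E.factor.eval Q.1 ≠ 0 := by
  cases E with
  | second f => simp [factor]
  | third a b => simpa [factor] using hQ.1

theorem factor_sq_mul_sq [CharP K 2] {E : Model K} {Q : K × K} (hQ : E.OnCurve Q) :
    E.factor.eval Q.1 ^ 2 * Q.2 ^ 2 =
      E.clearedRhs.eval Q.1 + E.factor.eval Q.1 ^ 2 * Q.2 := by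
  rw [← sub_eq_iff_eq_add, CharTwo.sub_eq_add, ← mul_add]
  cases E with
  | second f => simpa [factor, clearedRhs] using (show Q.2 ^ 2 + Q.2 = f.eval Q.1 from hQ)
  | third a b =>
    obtain ⟨h0, h⟩ := hQ
    simp only [factor, clearedRhs, eval_add, eval_mul, eval_C, eval_X, eval_pow]
    rw [h]
    field_simp

theorem OnCurve.add_one [CharP K 2] {E : Model K} {α β : K} (h : E.OnCurve (α, β)) :
    E.OnCurve (α, β + 1) := by
  have h1 : (β + 1) ^ 2 + (β + 1) = β ^ 2 + β := by
    linear_combination (β + 1) * CharTwo.two_eq_zero (R := K)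
  cases E with
  | second f => exact h1.trans h
  | third a b => exact ⟨h.1, h1.trans h.2⟩

theorem OnCurve.eq_or_eq_add_one [CharP K 2] {E : Model K} {α β β' : K}
    (h : E.OnCurve (α, β)) (h' : E.OnCurve (α, β')) : β' = β ∨ β' = β + 1 := by
  have h1 : β' ^ 2 + β' = β ^ 2 + β := by
    cases E with
    | second f => exact Eq.trans h' (Eq.symm h)
    | third a b => exact Eq.trans h'.2 (Eq.symm h.2)
  have h2 : (β' - β) * (β' - (β + 1)) = 0 := by
    linear_combination h1 + (β ^ 2 + β - β' * β - β') * CharTwo.two_eq_zero (R := K)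
  exact (mul_eq_zero.1 h2).imp sub_eq_zero.1 sub_eq_zero.1

theorem natDegree_sum_C_mul_X_pow_le (a : ℕ → K) {n N : ℕ} (h : n ≤ N + 1) :
    (∑ i ∈ Finset.range n, C (a i) * X ^ i).natDegree ≤ N :=
  natDegree_sum_le_of_forall_le _ _ fun i hi =>
    (natDegree_C_mul_X_pow_le (a i) i).trans (by have := Finset.mem_range.1 hi; omega)

theorem coeff_sum_C_mul_X_pow (a : ℕ → K) (n j : ℕ) :
    (∑ i ∈ Finset.range n, C (a i) * X ^ i).coeff j = if j < n then a j else 0 := by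
  simp [finsetSum_coeff, coeff_X_pow]

/-- With `k = 2 * d + 3` and `ℓ = d`, the twist is the tie `A_(d+2) = η * B_d`. -/
theorem mem_definingSetOdd {E : Model K} {d : ℕ} {η : K} {g : K[X][Y]} :
    g ∈ E.definingSetOdd (2 * d + 3) d η ↔
      ∃ A B : K[X], (A, B) ∈ twistedPairs (d + 2) d 1 η ∧ g = C A + C (B * E.factor) * Y := by
  have e1 : (2 * d + 3 - 1) / 2 + 1 = d + 2 := by omega
  have e2 : (2 * d + 3 - 3) / 2 + 1 = d + 1 := by omega
  have e3 : (2 * d + 3 + 1) / 2 = d + 2 := by omega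
  change (∃ a b : ℕ → K, _) ↔ _
  rw [e1, e2, e3]
  constructor
  · rintro ⟨a, b, rfl⟩
    refine ⟨∑ i ∈ Finset.range (d + 2), C (a i) * X ^ i + C (b d * η) * X ^ (d + 2),
      ∑ j ∈ Finset.range (d + 1), C (b j) * X ^ j, ⟨?_, ?_, ?_⟩, ?_⟩
    · exact natDegree_add_le_of_degree_le (natDegree_sum_C_mul_X_pow_le _ (by omega))
        (natDegree_C_mul_X_pow_le _ _)
    · exact natDegree_sum_C_mul_X_pow_le _ (by omega)
    · simp only [coeff_add, coeff_sum_C_mul_X_pow, coeff_C_mul, coeff_X_pow_self]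
      simp [mul_comm η]
    · rw [Finset.sum_mul, C_add]
      ring
  · rintro ⟨A, B, ⟨hA, hB, hAB⟩, rfl⟩
    refine ⟨A.coeff, B.coeff, ?_⟩
    conv_lhs => rw [A.as_sum_range_C_mul_X_pow' (n := d + 3) (by simp only at hA; omega),
      B.as_sum_range_C_mul_X_pow' (n := d + 1) (by simp only at hB; omega)]
    rw [Finset.sum_range_succ, ← Finset.sum_mul, C_add, mul_comm (B.coeff d) η, ← hAB, one_mul]
    ring

/-- With `k = 2 * d + 4` and `ℓ = d + 2`, the twist is the tie `η * A_(d+2) = B_(d+1)`. -/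
theorem mem_definingSetEven {E : Model K} {d : ℕ} {η : K} {g : K[X][Y]} :
    g ∈ E.definingSetEven (2 * d + 4) (d + 2) η ↔
      ∃ A B : K[X], (A, B) ∈ twistedPairs (d + 2) (d + 1) η 1 ∧
        g = C A + C (B * E.factor) * Y := by
  have e1 : (2 * d + 4) / 2 + 1 = d + 3 := by omega
  have e2 : (2 * d + 4 - 4) / 2 + 1 = d + 1 := by omega
  have e3 : (2 * d + 4 - 2) / 2 = d + 1 := by omega
  change (∃ a b : ℕ → K, _) ↔ _
  rw [e1, e2, e3]
  constructor
  · rintro ⟨a, b, rfl⟩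
    refine ⟨∑ i ∈ Finset.range (d + 3), C (a i) * X ^ i,
      ∑ j ∈ Finset.range (d + 1), C (b j) * X ^ j + C (a (d + 2) * η) * X ^ (d + 1),
      ⟨?_, ?_, ?_⟩, ?_⟩
    · exact natDegree_sum_C_mul_X_pow_le _ (by omega)
    · exact natDegree_add_le_of_degree_le (natDegree_sum_C_mul_X_pow_le _ (by omega))
        (natDegree_C_mul_X_pow_le _ _)
    · simp only [coeff_add, coeff_sum_C_mul_X_pow, coeff_C_mul, coeff_X_pow_self]
      simp [mul_comm η]
    · rw [add_mul, Finset.sum_mul, C_add]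
      ring
  · rintro ⟨A, B, ⟨hA, hB, hAB⟩, rfl⟩
    refine ⟨A.coeff, B.coeff, ?_⟩
    conv_lhs => rw [A.as_sum_range_C_mul_X_pow' (n := d + 3) (by simp only at hA; omega),
      B.as_sum_range_C_mul_X_pow' (n := d + 2) (by simp only at hB; omega)]
    rw [one_mul] at hAB
    rw [Finset.sum_range_succ _ (d + 1), ← Finset.sum_mul, add_mul, C_add, mul_comm _ η, hAB]
    ring

theorem map_evalMap_eq_map_pairEval {E : Model K} {n : ℕ} {P : Fin n → K × K} {v : Fin n → K}
    {S : Submodule K K[X][Y]} {V : Submodule K (K[X] × K[X])}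
    (hS : ∀ g, g ∈ S ↔ ∃ A B : K[X], (A, B) ∈ V ∧ g = C A + C (B * E.factor) * Y) :
    evalCode S P v = V.map (pairEval E.factor P v) := by
  have key : ∀ A B : K[X], evalMap P v (C A + C (B * E.factor) * Y) =
      pairEval E.factor P v (A, B) := by
    intro A B
    funext i
    change v i * evalEval _ _ _ = _
    rw [pairEval_apply]
    simp [evalEval_add, evalEval_mul, evalEval_C]
  ext c
  constructor
  · rintro ⟨g, hg, rfl⟩
    obtain ⟨A, B, hV, rfl⟩ := (hS g).1 hg
    exact ⟨(A, B), hV, (key A B).symm⟩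
  · rintro ⟨⟨A, B⟩, hV, rfl⟩
    exact ⟨_, (hS _).2 ⟨A, B, hV, rfl⟩, key A B⟩

theorem tgecc_odd (E : Model K) {n : ℕ} (P : Fin n → K × K) (d : ℕ) (η : K) (v : Fin n → K) :
    E.tgecc P (2 * d + 3) d η v = (twistedPairs (d + 2) d 1 η).map (pairEval E.factor P v) := by
  rw [tgecc, if_pos ⟨d + 1, by ring⟩]
  exact map_evalMap_eq_map_pairEval fun _ => mem_definingSetOdd

theorem tgecc_even (E : Model K) {n : ℕ} (P : Fin n → K × K) (d : ℕ) (η : K) (v : Fin n → K) :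
    E.tgecc P (2 * d + 4) (d + 2) η v =
      (twistedPairs (d + 2) (d + 1) η 1).map (pairEval E.factor P v) := by
  rw [tgecc, if_neg (Nat.not_odd_iff_even.2 ⟨d + 2, by ring⟩)]
  exact map_evalMap_eq_map_pairEval fun _ => mem_definingSetEven

namespace IsConorm

variable {E : Model K} {T : Finset K} {n : ℕ} {P : Fin n → K × K}

theorem mem (hP : E.IsConorm T P) (i : Fin n) : E.OnCurve (P i) ∧ (P i).1 ∈ T := by
  have : P i ∈ Set.range P := ⟨i, rfl⟩
  rwa [hP.range_eq] at this

theorem exists_index (hP : E.IsConorm T P) {Q : K × K} (h : E.OnCurve Q) (hQ : Q.1 ∈ T) :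
    ∃ i, P i = Q := by
  have : Q ∈ Set.range P := by rw [hP.range_eq]; exact ⟨h, hQ⟩
  exact this

/-- A sum over the points is a sum over `T` of the sums over the fibres. -/
theorem sum_eq [CharP K 2] (hP : E.IsConorm T P) {β : K → K}
    (hβ : ∀ α ∈ T, E.OnCurve (α, β α)) {M : Type*} [AddCommMonoid M] (F : K × K → M) :
    ∑ i, F (P i) = ∑ α ∈ T, (F (α, β α) + F (α, β α + 1)) := by
  classical
  have h1 : Finset.univ.image P =
      T.image (fun α => (α, β α)) ∪ T.image (fun α => (α, β α + 1)) := by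
    ext ⟨α, y⟩
    simp only [Finset.mem_image, Finset.mem_univ, true_and, Finset.mem_union, Prod.mk.injEq]
    constructor
    · rintro ⟨i, hi⟩
      obtain ⟨hc, hT⟩ := hP.mem i
      rw [hi] at hc hT
      rcases (hβ α hT).eq_or_eq_add_one hc with h | h
      · exact Or.inl ⟨α, hT, rfl, h.symm⟩
      · exact Or.inr ⟨α, hT, rfl, h.symm⟩
    · rintro (⟨α, hT, rfl, rfl⟩ | ⟨α, hT, rfl, rfl⟩)
      · exact hP.exists_index (hβ α hT) hT
      · exact hP.exists_index (hβ α hT).add_one hT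
  have h2 : Disjoint (T.image (fun α => (α, β α))) (T.image (fun α => (α, β α + 1))) := by
    rw [Finset.disjoint_left]
    rintro _ h3 h4
    obtain ⟨α, -, rfl⟩ := Finset.mem_image.1 h3
    obtain ⟨α', -, h5⟩ := Finset.mem_image.1 h4
    simp only [Prod.mk.injEq] at h5
    obtain ⟨rfl, h6⟩ := h5
    simp at h6
  rw [← Finset.sum_image (s := Finset.univ) (f := F) fun i _ j _ h => hP.injective h, h1,
    Finset.sum_union h2, Finset.sum_image fun _ _ _ _ h => congrArg Prod.fst h,
    Finset.sum_image fun _ _ _ _ h => congrArg Prod.fst h, ← Finset.sum_add_distrib]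

theorem exists_section (hP : E.IsConorm T P) : ∃ β : K → K, ∀ α ∈ T, E.OnCurve (α, β α) := by
  choose! β hβ using hP.exists_point
  exact ⟨β, hβ⟩

theorem two_mul_card [CharP K 2] (hP : E.IsConorm T P) : n = 2 * T.card := by
  obtain ⟨β, hβ⟩ := hP.exists_section
  simpa [mul_comm] using hP.sum_eq hβ fun _ => (1 : ℕ)

/-- Subtracting the values at the two points of a fibre isolates `B h`; then `B`, and after it `A`,
has more zeros than its degree. -/
theorem pairEval_injective [CharP K 2] (hP : E.IsConorm T P) {v : Fin n → K}
    (hv : ∀ i, v i ≠ 0) {g : K[X] × K[X]} (h1 : g.1.natDegree < T.card)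
    (h2 : g.2.natDegree < T.card) (hg : pairEval E.factor P v g = 0) : g = 0 := by
  have key : ∀ α y, α ∈ T → E.OnCurve (α, y) →
      g.1.eval α + g.2.eval α * E.factor.eval α * y = 0 := by
    intro α y hα hc
    obtain ⟨i, hi⟩ := hP.exists_index hc hα
    have h3 := congrFun hg i
    rw [pairEval_apply, hi] at h3
    exact (mul_eq_zero.1 h3).resolve_left (hv i)
  have hB : ∀ α ∈ T, g.2.eval α = 0 := by
    intro α hα
    obtain ⟨y, hy⟩ := hP.exists_point α hα
    have h3 := key α y hα hy
    have h4 := key α (y + 1) hα hy.add_one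
    have h5 : g.2.eval α * E.factor.eval α = 0 := by linear_combination h4 - h3
    exact (mul_eq_zero.1 h5).resolve_right (eval_factor_ne_zero hy)
  have hA : ∀ α ∈ T, g.1.eval α = 0 := by
    intro α hα
    obtain ⟨y, hy⟩ := hP.exists_point α hα
    simpa [hB α hα] using key α y hα hy
  have hdeg : ∀ f : K[X], f.natDegree < T.card → f.degree < T.card := fun f hf =>
    degree_le_natDegree.trans_lt (by exact_mod_cast hf)
  exact Prod.ext (eq_zero_of_degree_lt_of_eval_finset_eq_zero T (hdeg _ h1) hA)
    (eq_zero_of_degree_lt_of_eval_finset_eq_zero T (hdeg _ h2) hB)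

theorem pairEval_dotProduct [CharP K 2] (hP : E.IsConorm T P) {β : K → K}
    (hβ : ∀ α ∈ T, E.OnCurve (α, β α)) {v : Fin n → K} {w : K × K → K}
    (hw : ∀ i, w (P i) = v i ^ 2) (g g' : K[X] × K[X]) :
    pairEval E.factor P v g ⬝ᵥ pairEval E.factor P v g' =
      fibreForm T (fun α => w (α, β α) + w (α, β α + 1))
        (fun α => w (α, β α) * β α + w (α, β α + 1) * (β α + 1)) E.factor E.clearedRhs g g' := by
  let F : K × K → K := fun Q => w Q * ((g.1.eval Q.1 + g.2.eval Q.1 * E.factor.eval Q.1 * Q.2) *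
    (g'.1.eval Q.1 + g'.2.eval Q.1 * E.factor.eval Q.1 * Q.2))
  have h1 : ∀ i, pairEval E.factor P v g i * pairEval E.factor P v g' i =
      F (P i) := by
    intro i
    simp only [F, pairEval_apply, hw]
    ring
  rw [dotProduct, Finset.sum_congr rfl fun i _ => h1 i, hP.sum_eq hβ F, fibreForm]
  refine Finset.sum_congr rfl fun α hα => ?_
  have h2 := factor_sq_mul_sq (hβ α hα)
  have h3 := factor_sq_mul_sq (hβ α hα).add_one
  simp only [F, eval_add, eval_mul] at h2 h3 ⊢
  linear_combination (w (α, β α) * (g.2.eval α * g'.2.eval α)) * h2 +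
    (w (α, β α + 1) * (g.2.eval α * g'.2.eval α)) * h3

/-- The twisted code is self-dual if and only if the squares of the scaling factors are
proportional to the nodal weights divided by `h` and, for even `k`, the factor `h` is constant. -/
theorem isSelfDual_iff [CharP K 2] [DecidableEq K] (hE : E.IsElliptic) {k m d : ℕ} {s t : K}
    {P : Fin (2 * k) → K × K} (hP : E.IsConorm T P) {v : Fin (2 * k) → K} (hv : ∀ i, v i ≠ 0)
    (hk : k = m + d + 1) (hmd : m = d + 2 ∨ m = d + 1 ∧ 1 ≤ d) (hs : s ≠ 0) :
    IsSelfDual ((twistedPairs m d s t).map (pairEval E.factor P v)) ↔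
      (m = d + 1 → E.factor.coeff 1 = 0) ∧
        ∃ c, c ≠ 0 ∧ ∀ i, v i ^ 2 * E.factor.eval (P i).1 =
          c * Lagrange.nodalWeight T id (P i).1 := by
  have hT : T.card = m + d + 1 := by
    have := hP.two_mul_card
    omega
  obtain ⟨β, hβ⟩ := hP.exists_section
  -- The weights `v_i²` become a function of the point, so that sums over `i` can be regrouped by
  -- fibres.
  let w : K × K → K := Function.extend P (fun i => v i ^ 2) 0
  have hw : ∀ i, w (P i) = v i ^ 2 := fun i => hP.injective.extend_apply _ _ i
  have hw0 : ∀ α ∈ T, w (α, β α) ≠ 0 := by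
    intro α hα
    obtain ⟨i, hi⟩ := hP.exists_index (hβ α hα) hα
    rw [← hi, hw]
    exact pow_ne_zero _ (hv i)
  have hq : ∀ α, w (α, β α) + w (α, β α + 1) = 0 →
      w (α, β α) * β α + w (α, β α + 1) * (β α + 1) = w (α, β α) := by
    intro α h
    rw [CharTwo.add_eq_zero] at h
    rw [← h]
    linear_combination w (α, β α) * β α * CharTwo.two_eq_zero (R := K)
  have hfin : k ≤ Module.finrank K ((twistedPairs m d s t).map (pairEval E.factor P v)) := by
    refine hk.le.trans ?_
    exact le_finrank_map_twistedPairs hs fun g h1 h2 hg =>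
      hP.pairEval_injective hv (by omega) (by omega) hg
  have hform := fibreForm_eq_zero_iff (T := T)
    (p := fun α => w (α, β α) + w (α, β α + 1))
    (q := fun α => w (α, β α) * β α + w (α, β α + 1) * (β α + 1))
    (t := t) hT hmd E.natDegree_factor_le (natDegree_clearedRhs hE) hs
    (fun α hα => eval_factor_ne_zero (hβ α hα))
    (fun α hα h => by rw [hq α h]; exact hw0 α hα)
  rw [isSelfDual_iff_of_le_finrank hfin]
  simp only [Submodule.mem_map, forall_exists_index, and_imp, forall_apply_eq_imp_iff₂,
    hP.pairEval_dotProduct hβ hw]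
  refine hform.trans ?_
  refine and_congr_right fun _ => ?_
  constructor
  · rintro ⟨hp, c, hc, hc'⟩
    refine ⟨c, hc, fun i => ?_⟩
    obtain ⟨hcv, hα⟩ := hP.mem i
    rw [← hc' _ hα, hq _ (hp _ hα), ← hw]
    congr 1
    have h2 : P i = ((P i).1, (P i).2) := rfl
    rcases (hβ _ hα).eq_or_eq_add_one (h2 ▸ hcv) with h3 | h3
    · rw [h3] at h2; rw [← h2]
    · rw [h3] at h2
      rw [CharTwo.add_eq_zero.1 (hp _ hα), ← h2]
  · rintro ⟨c, hc, hc'⟩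
    have key : ∀ α y, α ∈ T → E.OnCurve (α, y) →
        w (α, y) * E.factor.eval α = c * Lagrange.nodalWeight T id α := by
      intro α y hα hy
      obtain ⟨i, hi⟩ := hP.exists_index hy hα
      have h2 := hc' i
      rwa [← hw, hi] at h2
    have hp : ∀ α ∈ T, w (α, β α) + w (α, β α + 1) = 0 := by
      intro α hα
      rw [CharTwo.add_eq_zero]
      exact mul_right_cancel₀ (eval_factor_ne_zero (hβ α hα))
        ((key α _ hα (hβ α hα)).trans (key α _ hα (hβ α hα).add_one).symm)
    refine ⟨hp, c, hc, fun α hα => ?_⟩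
    rw [hq α (hp α hα)]
    exact key α _ hα (hβ α hα)

/-- In characteristic two the values of a function of `x` cancel in pairs. -/
theorem sum_fst_eq_zero [CharP K 2] (hP : E.IsConorm T P) (F : K → K) :
    ∑ i, F (P i).1 = 0 := by
  obtain ⟨β, hβ⟩ := hP.exists_section
  rw [hP.sum_eq hβ fun Q => F Q.1]
  exact Finset.sum_eq_zero fun α _ => CharTwo.add_self_eq_zero _

theorem sum_fst_mul_snd [CharP K 2] (hP : E.IsConorm T P) (F : K → K) :
    ∑ i, F (P i).1 * (P i).2 = ∑ α ∈ T, F α := by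
  obtain ⟨β, hβ⟩ := hP.exists_section
  rw [hP.sum_eq hβ fun Q => F Q.1 * Q.2]
  refine Finset.sum_congr rfl fun α _ => ?_
  linear_combination F α * β α * CharTwo.two_eq_zero (R := K)

theorem sum_fst_mul_snd_sq [CharP K 2] (hP : E.IsConorm T P) (F : K → K) :
    ∑ i, F (P i).1 * (P i).2 ^ 2 = ∑ α ∈ T, F α := by
  obtain ⟨β, hβ⟩ := hP.exists_section
  rw [hP.sum_eq hβ fun Q => F Q.1 * Q.2 ^ 2]
  refine Finset.sum_congr rfl fun α _ => ?_
  linear_combination F α * (β α ^ 2 + β α) * CharTwo.two_eq_zero (R := K)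

end IsConorm

end Model

end Curve

end TwistedEllipticCode

/-! ### The four cases. -/

theorem mainTheorem9 {K : Type*} [Field K] [Finite K] [CharP K 2] (k : ℕ) (hk : 3 ≤ k)
    (T : Finset K) (P : Fin (2 * k) → K × K) (v γ : Fin (2 * k) → K) (hv : ∀ i, v i ≠ 0)
    (η : K) (hη : η ≠ 0) :
    -- the second type `y ^ 2 + y = f(x)`
    (∀ f : Polynomial K, (Model.second f).IsElliptic → (Model.second f).IsConorm T P →
      (∀ i, γ i = (Model.second f).gamma T (P i)) →
      (Odd k →
        (IsSelfDual ((Model.second f).tgecc P k ((k - 3) / 2) η v) ↔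
          ∑ i, γ i * (P i).1 ^ (k + 1) = 0 ∧
          ∃ c : K, c ≠ 0 ∧ ∀ i, v i ^ 2 = c * γ i)) ∧
      (Even k →
        (IsSelfDual ((Model.second f).tgecc P k (k / 2) η v) ↔
          ∑ i, γ i * (P i).1 ^ (k - 2) * (P i).2 ^ 2 = 0 ∧
          ∃ c : K, c ≠ 0 ∧ ∀ i, v i ^ 2 = c * γ i))) ∧
    -- the third type `y ^ 2 + y = x + 1 / (a x + b)`
    (∀ a b : K, (Model.third a b).IsElliptic → (Model.third a b).IsConorm T P →
      (∀ i, γ i = (Model.third a b).gamma T (P i)) →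
      (Odd k →
        (IsSelfDual ((Model.third a b).tgecc P k ((k - 3) / 2) η v) ↔
          ∑ i, γ i / (a * (P i).1 + b) * (P i).1 ^ (k + 1) = 0 ∧
          ∃ c : K, c ≠ 0 ∧ ∀ i, v i ^ 2 = c * γ i / (a * (P i).1 + b))) ∧
      (Even k →
        (IsSelfDual ((Model.third a b).tgecc P k (k / 2) η v) ↔
          ∑ i, γ i * (a * (P i).1 + b) * (P i).1 ^ (k - 2) * (P i).2 = 0 ∧
          ∃ c : K, c ≠ 0 ∧ ∀ i, v i ^ 2 = c * γ i / (a * (P i).1 + b)))) := by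
  classical
  have hγ : ∀ {E : Model K}, E.IsConorm T P → (∀ i, γ i = E.gamma T (P i)) →
      ∀ i, γ i = Lagrange.nodalWeight T id (P i).1 := fun hP h i =>
    (h i).trans (gamma_eq_nodalWeight _ (hP.mem i).2)
  have hcard : ∀ {E : Model K}, E.IsConorm T P → T.card = k := fun hP => by
    have := hP.two_mul_card
    omega
  refine ⟨fun f hE hP h => ?_, fun a b hE hP h => ?_⟩
  · have hγ' := hγ hP h
    have hT := hcard hP
    have hfac : (Model.second f).factor = 1 := rfl
    constructor
    · rintro ⟨e, he⟩
      obtain ⟨d, rfl⟩ : ∃ d, k = 2 * d + 3 := ⟨e - 1, by omega⟩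
      rw [show (2 * d + 3 - 3) / 2 = d by omega, Model.tgecc_odd,
        hP.isSelfDual_iff hE hv (by omega) (Or.inl rfl) one_ne_zero]
      simp only [hfac, eval_one, mul_one, hγ']
      -- Here `m = d + 2`, so there is no condition on `h`, and the sum cancels in pairs on the
      -- fibres.
      refine and_congr_left fun _ => iff_of_true (fun h1 => by omega) ?_
      exact hP.sum_fst_eq_zero fun x => Lagrange.nodalWeight T id x * x ^ (2 * d + 3 + 1)
    · rintro ⟨e, he⟩
      obtain ⟨d, rfl⟩ : ∃ d, k = 2 * d + 4 := ⟨e - 2, by omega⟩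
      rw [show (2 * d + 4) / 2 = d + 2 by omega, Model.tgecc_even,
        hP.isSelfDual_iff hE hv (by omega) (Or.inr ⟨rfl, by omega⟩) hη]
      simp only [hfac, eval_one, mul_one, hγ']
      refine and_congr_left fun _ => iff_of_true (fun _ => by simp [coeff_one]) ?_
      rw [hP.sum_fst_mul_snd_sq fun x => Lagrange.nodalWeight T id x * x ^ (2 * d + 4 - 2)]
      -- The exponent `k - 2` is below `#T - 1`, so the sum is zero.
      have h1 := sum_nodalWeight_mul_eval T (B := X ^ (2 * d + 4 - 2))
        ((degree_X_pow_le _).trans_lt (by rw [hT]; norm_cast; omega))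
      rw [coeff_X_pow, hT, if_neg (by omega)] at h1
      simpa using h1
  · have hγ' := hγ hP h
    have hT := hcard hP
    have ha : a ≠ 0 := hE
    have hfac : (Model.third a b).factor = C a * X + C b := rfl
    have hev : ∀ x, (Model.third a b).factor.eval x = a * x + b := fun x => by simp [hfac]
    have hv' : (∃ c : K, c ≠ 0 ∧ ∀ i, v i ^ 2 * (Model.third a b).factor.eval (P i).1 =
        c * Lagrange.nodalWeight T id (P i).1) ↔
        ∃ c : K, c ≠ 0 ∧ ∀ i, v i ^ 2 = c * γ i / (a * (P i).1 + b) := by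
      refine exists_congr fun c => and_congr_right fun _ => forall_congr' fun i => ?_
      rw [hγ', hev, eq_div_iff (hP.mem i).1.1]
    constructor
    · rintro ⟨e, he⟩
      obtain ⟨d, rfl⟩ : ∃ d, k = 2 * d + 3 := ⟨e - 1, by omega⟩
      rw [show (2 * d + 3 - 3) / 2 = d by omega, Model.tgecc_odd,
        hP.isSelfDual_iff hE hv (by omega) (Or.inl rfl) one_ne_zero, hv']
      refine and_congr_left fun _ => iff_of_true (fun h1 => by omega) ?_
      simp only [hγ']
      exact hP.sum_fst_eq_zero fun x =>
        Lagrange.nodalWeight T id x / (a * x + b) * x ^ (2 * d + 3 + 1)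
    · rintro ⟨e, he⟩
      obtain ⟨d, rfl⟩ : ∃ d, k = 2 * d + 4 := ⟨e - 2, by omega⟩
      rw [show (2 * d + 4) / 2 = d + 2 by omega, Model.tgecc_even,
        hP.isSelfDual_iff hE hv (by omega) (Or.inr ⟨rfl, by omega⟩) hη, hv']
      refine and_congr_left fun _ => ?_
      -- The sum is the coefficient of `(a x + b) x ^ (k - 2)` at `k - 1`, which is the linear
      -- coefficient of `h`.
      have h1 := sum_nodalWeight_mul_eval T (B := (C a * X + C b) * X ^ (2 * d + 2)) (by
        rw [hT]
        refine degree_le_natDegree.trans_lt ?_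
        have := natDegree_mul_le_of_le (natDegree_linear_le (a := a) (b := b))
          (natDegree_X_pow_le (R := K) (2 * d + 2))
        norm_cast
        omega)
      rw [hT, show 2 * d + 4 - 1 = 1 + (2 * d + 2) by omega, coeff_mul_X_pow] at h1
      simp only [hγ', show 2 * d + 4 - 2 = 2 * d + 2 by omega]
      rw [hP.sum_fst_mul_snd fun x =>
        Lagrange.nodalWeight T id x * (a * x + b) * x ^ (2 * d + 2), hfac, ← h1]
      simp [mul_assoc]
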